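/- Urn processes. An urn contains white and black balls. At each time $1,2,\dots$ a ball is drawn uniformly at random, independently of the previous draws, its colour is noted and it is put back. If the drawn ball is white, one black ball is replaced by a white one; if it is black, one white ball is replaced by a black one. The process stops as soon as all remaining balls have the same colour. Let $W_n,B_n$ be the numbers of white and black balls after $n$ draws and $H=\min\{n: W_n=0\text{ or }B_n=0\}$. For the process started from $w$ white and $b$ black balls put $V(w,b)=\mathbb E(B_H)$ and $T(w,b)=\mathbb E(H)$. The controlled process is obtained by applying Policy A at time $0$ and after every draw: if the number of white balls is at least the number of black balls, white balls are removed permanently until their number is one less than the number of black balls; otherwise nothing is done. $V^A(w,b)$ and $T^A(w,b)$ denote the expected final number of black balls and the expected time to absorption in the controlled process. Proposition. Fix $\tfrac12<x<1$ and, for $N\in\mathbb N$, let $b=\lceil xN\rceil$ and $w=\lfloor(1-x)N\rfloor$. Then the expected absorption times $T(w,b)$ and $T^A(w,b)$ are finite, and as $N\to\infty$ $$V^A(w,b)\sim V(w,b)\sim N,\qquad T^A(w,b)\sim T(w,b)\sim \frac N2\ln\Big(\frac1{2x-1}\Big),$$ where $f\sim g$ means $f/g\to1$. Moreover, if the controlled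 and the uncontrolled process are both started from $(w,b)$ and driven by the same random draws (each draw being selected by the same uniform random number in both processes), then the probability that they coincide at all times tends to $1$ as $N\to\infty$. -/

import Mathlib

open MeasureTheory Filter Asymptotics Topology

noncomputable section

namespace Mabinogion

/-- A content of the urn: (number of white balls, number of black balls). -/
abbrev State : Type := ℕ × ℕ

/-- All remaining balls have the same colour: there is no white ball or no black ball. -/
def Absorbed (s : State) : Prop := s.1 = 0 ∨ s.2 = 0

open Classical in
/-- One step of the urn. A number `u` uniform in `[0, 1]` selects one of the balls uniformly: the
drawn ball is white when `u * (white + black) < white`, hence with probability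
`white / (white + black)`, and black otherwise. If a white ball is drawn, a black ball is
replaced by a white one; if a black ball is drawn, a white ball is replaced by a black one.
The process has stopped once only one colour is left. -/
def step (s : State) (u : unitInterval) : State :=
  if Absorbed s then s
  else if (u : ℝ) * ((s.1 : ℝ) + (s.2 : ℝ)) < (s.1 : ℝ) then (s.1 + 1, s.2 - 1)
  else (s.1 - 1, s.2 + 1)

/-- Policy A: if there are at least as many white as black balls, reduce the number of white balls
to one less than the number of black balls; otherwise do nothing. (With no black ball in the urn
the process has stopped and nothing is removed.) -/
def policyA (s : State) : State :=
  if s.2 ≤ s.1 ∧ 0 < s.2 then (s.2 - 1, s.2) else s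

/-- The infinite sequences of random numbers that select the drawn balls;
entry `n` is used for the draw at time `n + 1`. -/
abbrev Draws : Type := ℕ → unitInterval

/-- The draws are independent and uniform. -/
def drawLaw : Measure Draws := Measure.infinitePi fun _ : ℕ => (volume : Measure unitInterval)

/-- The uncontrolled process started from `s`: the urn after `n` draws. -/
def mPath (s : State) (u : Draws) : ℕ → State
  | 0 => s
  | n + 1 => step (mPath s u n) (u n)

/-- The process controlled by Policy A and started from `s`: the policy is applied at time `0` and
after every draw. -/
def aPath (s : State) (u : Draws) : ℕ → State
  | 0 => policyA s
  | n + 1 => policyA (step (aPath s u n) (u n))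

/-- The time of absorption of a path (`⊤` if the path is never absorbed). -/
def absorptionTime (p : ℕ → State) : ℕ∞ :=
  sInf ((fun n : ℕ => (n : ℕ∞)) '' {n : ℕ | Absorbed (p n)})

/-- The number of black balls at the time of absorption of a path. -/
def finalBlack (p : ℕ → State) : ℕ := (p (absorptionTime p).toNat).2

/-- Expected final number of black balls in the uncontrolled process from `w` white and `b` black
balls. -/
def V (w b : ℕ) : ℝ := ∫ u, (finalBlack (mPath (w, b) u) : ℝ) ∂drawLaw

/-- Expected final number of black balls in the process controlled by Policy A. -/
def VA (w b : ℕ) : ℝ := ∫ u, (finalBlack (aPath (w, b) u) : ℝ) ∂drawLaw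

/-- Expected time to absorption in the uncontrolled process, with values in `[0, ∞]`. -/
def T (w b : ℕ) : ENNReal := ∫⁻ u, (absorptionTime (mPath (w, b) u) : ENNReal) ∂drawLaw

/-- Expected time to absorption in the process controlled by Policy A, with values in `[0, ∞]`. -/
def TA (w b : ℕ) : ENNReal := ∫⁻ u, (absorptionTime (aPath (w, b) u) : ENNReal) ∂drawLaw

/-- The initial number `⌊(1 - x) N⌋` of white balls. -/
def initW (x : ℝ) (N : ℕ) : ℕ := ⌊(1 - x) * (N : ℝ)⌋₊

/-- The initial number `⌈x N⌉` of black balls. -/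
def initB (x : ℝ) (N : ℕ) : ℕ := ⌈x * (N : ℝ)⌉₊

end Mabinogion

end

noncomputable section

namespace Mabinogion

/-! Let `N` be the total and `D` the excess of black over white balls. A draw moves `D` by ±2 with
mean increment `2D/N`, so the excess reinforces itself: on average it follows `D·exp(2n/N)`, which
reaches `N` at time `(N/2) ln(N/D)`. Since `D ≈ (2x-1)N` at the start, this is the claimed time. The
rigorous argument uses test functions. By first-step analysis, a nonnegative function whose mean
drops by at least one per draw bounds the expected absorption time from above; a bounded function
vanishing at absorption whose mean drops by at most one bounds it from below; a nonnegative
supermartingale that is at least one on a set bounds the probability of visiting it. If Policy A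
moves the function in the favourable direction, the same function serves both processes (`T_TA_le`,
`le_T_TA`). Three functions suffice. (1) `barrier` is a supermartingale where `ρw ≤ b` and at least
1 elsewhere. For `1 < ρ < x/(1-x)` it is exponentially small at the start, so Policy A is unlikely
ever to act (`drawLaw_policyActs_le_barrier`). This gives the coupling, and also both values `V`:
unless a state is met where Policy A acts, black cannot die out, so the last `N` balls are all
black. (2) `fluidTime` drops on average by between `1 - O(1/N)` and 1 inside that region. (3) The
product `wb` drops by at least one everywhere, which gives finiteness and a crude bound outside the
region. Gluing (2) to the crude bounds costs `N² · barrier`, which tends to 0. -/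

instance : IsProbabilityMeasure drawLaw := by unfold drawLaw; infer_instance

/-! ### Shift structure of the draws and first-step analysis -/

/-- Prepend a draw to a sequence of draws. -/
def consDraw (p : unitInterval × Draws) : Draws
  | 0 => p.1
  | n + 1 => p.2 n

lemma measurable_consDraw : Measurable consDraw := by
  refine measurable_pi_lambda _ fun n => ?_
  cases n with
  | zero => exact measurable_fst
  | succ n => exact (measurable_pi_apply n).comp measurable_snd

/-- An independent uniform draw put in front of an i.i.d. uniform sequence gives the same law; it
suffices to compare measures of finite boxes. -/
lemma map_consDraw :
    ((volume : Measure unitInterval).prod drawLaw).map consDraw = drawLaw := by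
  refine Measure.eq_infinitePi _ fun s t ht => ?_
  classical
  obtain ⟨m, hm⟩ : ∃ m, s ⊆ Finset.range (m + 1) :=
    ⟨s.sup id, fun i hi => Finset.mem_range_succ_iff.2 (Finset.le_sup (f := id) hi)⟩
  -- Padding the box with full factors to an initial segment of indices lets coordinate 0 split off.
  set t' : ℕ → Set unitInterval := fun i => if i ∈ s then t i else Set.univ with ht'
  have hmeas : ∀ i, MeasurableSet (t' i) := fun i => by
    simp only [ht']; split_ifs
    exacts [ht i, MeasurableSet.univ]
  have hpi : Set.pi (s : Set ℕ) t = Set.pi (Finset.range (m + 1) : Set ℕ) t' := by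
    ext u
    simp only [Set.mem_pi, ht', Finset.mem_coe]
    constructor
    · intro h i _
      split_ifs with hi
      exacts [h i hi, trivial]
    · intro h i hi
      simpa [hi] using h i (hm hi)
  have hprod : ∏ i ∈ s, (volume : Measure unitInterval) (t i)
      = ∏ i ∈ Finset.range (m + 1), (volume : Measure unitInterval) (t' i) := by
    rw [← Finset.prod_subset hm]
    · exact Finset.prod_congr rfl fun i hi => by simp [ht', hi]
    · intro i _ hi
      simp [ht', hi]
  have hpre : consDraw ⁻¹' Set.pi (Finset.range (m + 1) : Set ℕ) t'
      = t' 0 ×ˢ Set.pi (Finset.range m : Set ℕ) (fun i => t' (i + 1)) := by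
    ext ⟨v, u⟩
    simp only [Set.mem_preimage, Set.mem_pi, Set.mem_prod, Finset.coe_range, Set.mem_Iio]
    constructor
    · exact fun h => ⟨h 0 (Nat.succ_pos m), fun i hi => h (i + 1) (Nat.succ_lt_succ hi)⟩
    · rintro ⟨h0, h⟩ i hi
      cases i with
      | zero => exact h0
      | succ i => exact h i (Nat.lt_of_succ_lt_succ hi)
  rw [hpi, hprod, Measure.map_apply measurable_consDraw
    (MeasurableSet.pi (Finset.countable_toSet _) fun i _ => hmeas i), hpre, Measure.prod_prod,
    drawLaw, Measure.infinitePi_pi _ (fun i _ => hmeas (i + 1)), Finset.prod_range_succ', mul_comm]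

/-- The path driven by the draws `u` of the chain with transition map `K`. -/
def chain (K : State → unitInterval → State) (s : State) (u : Draws) : ℕ → State
  | 0 => s
  | n + 1 => K (chain K s u n) (u n)

lemma mPath_eq_chain (s : State) (u : Draws) : mPath s u = chain step s u := by
  funext n
  induction n with
  | zero => rfl
  | succ n ih => simp only [mPath, chain, ih]

lemma aPath_eq_chain (s : State) (u : Draws) :
    aPath s u = chain (fun r v => policyA (step r v)) (policyA s) u := by
  funext n
  induction n with
  | zero => rfl
  | succ n ih => simp only [aPath, chain, ih]

lemma chain_consDraw (K : State → unitInterval → State) (s : State) (v : unitInterval)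
    (u : Draws) (n : ℕ) : chain K s (consDraw (v, u)) (n + 1) = chain K (K s v) u n := by
  induction n with
  | zero => rfl
  | succ n ih =>
    rw [chain, ih]
    rfl

variable {K : State → unitInterval → State}

lemma measurable_chain (hK : ∀ s, Measurable (K s)) (n : ℕ) :
    Measurable fun p : State × Draws => chain K p.1 p.2 n := by
  induction n with
  | zero => exact measurable_fst
  | succ n ih =>
    have h : Measurable fun p : State × unitInterval => K p.1 p.2 :=
      measurable_from_prod_countable_right hK
    exact h.comp (ih.prodMk ((measurable_pi_apply n).comp measurable_snd))

lemma measurable_chain_right (hK : ∀ s, Measurable (K s)) (s : State) (n : ℕ) :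
    Measurable fun u : Draws => chain K s u n :=
  (measurable_chain hK n).comp measurable_prodMk_left

/-- First-step decomposition of an event about the whole path. -/
lemma drawLaw_first_step (hK : ∀ s, Measurable (K s)) (s : State) {A B : Set (ℕ → State)}
    (hA : MeasurableSet A) (hAB : ∀ p : ℕ → State, p 0 = s → (p ∈ A ↔ (fun n => p (n + 1)) ∈ B)) :
    drawLaw {u | chain K s u ∈ A} = ∫⁻ v, drawLaw {u | chain K (K s v) u ∈ B} := by
  have hm : MeasurableSet {u : Draws | chain K s u ∈ A} :=
    (measurable_pi_lambda _ fun n => measurable_chain_right hK s n) hA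
  conv_lhs => rw [← map_consDraw]
  rw [Measure.map_apply measurable_consDraw hm,
    Measure.prod_apply (measurable_consDraw hm)]
  refine lintegral_congr fun v => congrArg _ ?_
  ext u
  have : (fun n => chain K s (consDraw (v, u)) (n + 1)) = chain K (K s v) u :=
    funext fun n => chain_consDraw K s v u n
  simp only [Set.mem_preimage, Set.mem_ofPred_eq]
  rw [hAB _ rfl, this]

/-! ### Absorption times and drift criteria for general chains -/

/-- The probability that the chain is not yet absorbed at time `n`. -/
def aliveProb (K : State → unitInterval → State) (s : State) (n : ℕ) : ENNReal :=
  drawLaw {u | ¬ Absorbed (chain K s u n)}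

lemma aliveProb_succ (hK : ∀ s, Measurable (K s)) (s : State) (n : ℕ) :
    aliveProb K s (n + 1) = ∫⁻ v, aliveProb K (K s v) n := by
  refine drawLaw_first_step hK s (A := {p | ¬ Absorbed (p (n + 1))}) (B := {p | ¬ Absorbed (p n)})
    ?_ fun p _ => Iff.rfl
  exact measurable_pi_apply (X := fun _ : ℕ => State) (n + 1)
    (MeasurableSet.of_discrete (s := {s : State | ¬ Absorbed s}))

lemma aliveProb_zero (s : State) [Decidable (Absorbed s)] :
    aliveProb K s 0 = if Absorbed s then 0 else 1 := by
  unfold aliveProb chain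
  split_ifs with h <;> simp [h]

lemma chain_absorbed (hfix : ∀ s v, Absorbed s → K s v = s) {s : State} {u : Draws} {m n : ℕ}
    (hmn : m ≤ n) (h : Absorbed (chain K s u m)) : Absorbed (chain K s u n) := by
  induction n, hmn using Nat.le_induction with
  | base => exact h
  | succ n _ ih => rw [chain, hfix _ _ ih]; exact ih

lemma aliveProb_absorbed (hfix : ∀ s v, Absorbed s → K s v = s) {s : State} (h : Absorbed s)
    (n : ℕ) : aliveProb K s n = 0 := by
  unfold aliveProb
  have : {u : Draws | ¬ Absorbed (chain K s u n)} = ∅ := by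
    ext u
    simpa using chain_absorbed (u := u) hfix (Nat.zero_le n) h
  rw [this, measure_empty]

open Classical in
lemma absorptionTime_eq_tsum (p : ℕ → State) (hp : ∀ m n, m ≤ n → Absorbed (p m) → Absorbed (p n)) :
    (absorptionTime p : ENNReal) = ∑' n, if Absorbed (p n) then 0 else 1 := by
  by_cases h : ∃ n, Absorbed (p n)
  · have hiff : ∀ n, Absorbed (p n) ↔ Nat.find h ≤ n := fun n =>
      ⟨fun hn => Nat.find_min' h hn, fun hn => hp _ _ hn (Nat.find_spec h)⟩
    have ht : absorptionTime p = (Nat.find h : ℕ∞) := by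
      refine le_antisymm (sInf_le ⟨_, Nat.find_spec h, rfl⟩) (le_sInf ?_)
      rintro _ ⟨n, hn, rfl⟩
      exact Nat.cast_le.2 ((hiff n).1 hn)
    rw [ht, tsum_eq_sum (s := Finset.range (Nat.find h))]
    · rw [Finset.sum_congr rfl (g := fun _ => (1 : ENNReal))]
      · simp
      · intro n hn
        rw [if_neg]
        rw [hiff]
        simpa using hn
    · intro n hn
      rw [if_pos]
      rw [hiff]
      simpa using hn
  · push Not at h
    have ht : absorptionTime p = ⊤ := by
      unfold absorptionTime
      have : {n : ℕ | Absorbed (p n)} = ∅ := by ext n; simp [h n]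
      rw [this, Set.image_empty, sInf_empty]
    simp [ht, h]

/-- The tail-sum formula `E(H) = ∑ P(H > n)`, valid because absorbed states are fixed. -/
lemma lintegral_absorptionTime (hK : ∀ s, Measurable (K s))
    (hfix : ∀ s v, Absorbed s → K s v = s) (s : State) :
    ∫⁻ u, (absorptionTime (chain K s u) : ENNReal) ∂drawLaw = ∑' n, aliveProb K s n := by
  classical
  have hset : ∀ n, MeasurableSet {u : Draws | ¬ Absorbed (chain K s u n)} := fun n =>
    measurable_chain_right hK s n (MeasurableSet.of_discrete (s := {s : State | ¬ Absorbed s}))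
  have h : ∀ u, (absorptionTime (chain K s u) : ENNReal)
      = ∑' n, {u : Draws | ¬ Absorbed (chain K s u n)}.indicator (fun _ => (1 : ENNReal)) u := by
    intro u
    rw [absorptionTime_eq_tsum _ fun m n hmn => chain_absorbed hfix hmn]
    refine tsum_congr fun n => ?_
    by_cases h : Absorbed (chain K s u n) <;> simp [h]
  simp_rw [h]
  rw [lintegral_tsum fun n => (measurable_const.indicator (hset n)).aemeasurable]
  refine tsum_congr fun n => ?_
  rw [lintegral_indicator (hset n)]
  simp [aliveProb]

lemma measurable_aliveProb_step (hK : ∀ s, Measurable (K s)) (s : State) (n : ℕ) :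
    Measurable fun v => aliveProb K (K s v) n :=
  (Measurable.of_discrete (f := fun r => aliveProb K r n)).comp (hK s)

lemma sum_aliveProb_succ (hK : ∀ s, Measurable (K s)) (s : State) (n : ℕ) :
    ∑ k ∈ Finset.range (n + 1), aliveProb K s k
      = (∫⁻ v, ∑ k ∈ Finset.range n, aliveProb K (K s v) k) + aliveProb K s 0 := by
  rw [Finset.sum_range_succ', lintegral_finsetSum _ fun k _ => measurable_aliveProb_step hK s k]
  simp_rw [aliveProb_succ hK]

/-- A nonnegative function that decreases by at least one on average in each step bounds the
expected absorption time from above. -/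
lemma lintegral_absorptionTime_le (hK : ∀ s, Measurable (K s))
    (hfix : ∀ s v, Absorbed s → K s v = s) {F : State → ENNReal}
    (hF : ∀ s, ¬ Absorbed s → (∫⁻ v, F (K s v)) + 1 ≤ F s) (s : State) :
    ∫⁻ u, (absorptionTime (chain K s u) : ENNReal) ∂drawLaw ≤ F s := by
  classical
  rw [lintegral_absorptionTime hK hfix]
  refine ENNReal.tsum_le_of_sum_range_le fun n => ?_
  induction n generalizing s with
  | zero => simp
  | succ n ih =>
    by_cases hs : Absorbed s
    · simp [aliveProb_absorbed hfix hs]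
    · rw [sum_aliveProb_succ hK, aliveProb_zero, if_neg hs]
      refine le_trans ?_ (hF s hs)
      gcongr with v
      exact ih _

/-- A bounded function that vanishes at absorption and decreases by at most one on average in each
step bounds the expected absorption time from below. -/
lemma le_lintegral_absorptionTime (hK : ∀ s, Measurable (K s))
    (hfix : ∀ s v, Absorbed s → K s v = s) {F : State → ENNReal} {M : ENNReal} (hM : M ≠ ⊤)
    (hFM : ∀ s, F s ≤ M) (hF0 : ∀ s, Absorbed s → F s = 0)
    (hF : ∀ s, ¬ Absorbed s → F s ≤ (∫⁻ v, F (K s v)) + 1) (s : State) :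
    F s ≤ ∫⁻ u, (absorptionTime (chain K s u) : ENNReal) ∂drawLaw := by
  classical
  rw [lintegral_absorptionTime hK hfix]
  by_cases htop : ∑' n, aliveProb K s n = ⊤
  · rw [htop]; exact le_top
  -- Iterating the drift inequality `n` times leaves the mean of `F` on the paths still alive, at
  -- most `M` times their probability. This remainder vanishes when the tail sum converges.
  have key : ∀ n s, F s ≤ ∑ k ∈ Finset.range n, aliveProb K s k + M * aliveProb K s n := by
    intro n
    induction n with
    | zero =>
      intro s
      by_cases hs : Absorbed s
      · simp [hF0 s hs]
      · simpa [aliveProb_zero, hs] using hFM s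
    | succ n ih =>
      intro s
      by_cases hs : Absorbed s
      · simp [hF0 s hs]
      · rw [sum_aliveProb_succ hK, aliveProb_zero, if_neg hs, aliveProb_succ hK,
          ← lintegral_const_mul _ (measurable_aliveProb_step hK s n), add_right_comm,
          ← lintegral_add_right _ ((measurable_aliveProb_step hK s n).const_mul M)]
        refine (hF s hs).trans ?_
        gcongr with v
        exact ih _
  have hlim : Tendsto (fun n => ∑ k ∈ Finset.range n, aliveProb K s k + M * aliveProb K s n) atTop
      (𝓝 (∑' n, aliveProb K s n + M * 0)) :=
    (ENNReal.summable.hasSum.tendsto_sum_nat).add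
      (ENNReal.Tendsto.const_mul (ENNReal.tendsto_atTop_zero_of_tsum_ne_top htop) (Or.inr hM))
  rw [mul_zero, add_zero] at hlim
  exact ge_of_tendsto' hlim fun n => key n s

/-- A nonnegative function that decreases on average in each step and is at least one on `A` bounds
the probability that the chain ever visits `A`. -/
lemma drawLaw_exists_mem_le (hK : ∀ s, Measurable (K s)) {A : Set State} {F : State → ENNReal}
    (hFA : ∀ s ∈ A, 1 ≤ F s) (hF : ∀ s, s ∉ A → ∫⁻ v, F (K s v) ≤ F s) (s : State) :
    drawLaw {u | ∃ n, chain K s u n ∈ A} ≤ F s := by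
  -- A finite horizon allows induction by first steps; monotone continuity of the measure then
  -- removes it.
  have key : ∀ n s, drawLaw {u | ∃ k ≤ n, chain K s u k ∈ A} ≤ F s := by
    intro n
    induction n with
    | zero =>
      intro s
      by_cases hs : s ∈ A
      · exact prob_le_one.trans (hFA s hs)
      · simp [chain, hs]
    | succ n ih =>
      intro s
      by_cases hs : s ∈ A
      · exact prob_le_one.trans (hFA s hs)
      · refine le_trans (le_of_eq ?_) ((lintegral_mono fun v => ih (K s v)).trans (hF s hs))
        refine drawLaw_first_step hK s (A := {p | ∃ k ≤ n + 1, p k ∈ A})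
          (B := {p | ∃ k ≤ n, p k ∈ A}) ?_ fun p hp => ?_
        · have : {p : ℕ → State | ∃ k ≤ n + 1, p k ∈ A}
              = ⋃ k ∈ Finset.range (n + 2), (fun p : ℕ → State => p k) ⁻¹' A := by
            ext p
            simp [Nat.lt_succ_iff]
          rw [this]
          exact Finset.measurableSet_biUnion _ fun k _ =>
            measurable_pi_apply k MeasurableSet.of_discrete
        · constructor
          · rintro ⟨k, hk, hkA⟩
            cases k with
            | zero => exact absurd (hp ▸ hkA) hs
            | succ k => exact ⟨k, Nat.le_of_succ_le_succ hk, hkA⟩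
          · rintro ⟨k, hk, hkA⟩
            exact ⟨k + 1, Nat.succ_le_succ hk, hkA⟩
  have hU : {u | ∃ n, chain K s u n ∈ A} = ⋃ n, {u | ∃ k ≤ n, chain K s u k ∈ A} := by
    ext u
    simp only [Set.mem_ofPred_eq, Set.mem_iUnion]
    exact ⟨fun ⟨n, hn⟩ => ⟨n, n, le_rfl, hn⟩, fun ⟨_, k, _, hk⟩ => ⟨k, hk⟩⟩
  have hmono : Monotone fun n => {u | ∃ k ≤ n, chain K s u k ∈ A} :=
    fun m n hmn u ⟨k, hk, hkA⟩ => ⟨k, hk.trans hmn, hkA⟩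
  rw [hU, hmono.measure_iUnion]
  exact iSup_le fun n => key n s

/-! ### Urn transitions and drift criteria for both processes -/

lemma not_absorbed_iff {w b : ℕ} : ¬ Absorbed (w, b) ↔ 0 < w ∧ 0 < b := by
  simp only [Absorbed]; omega

lemma step_of_absorbed {s : State} (h : Absorbed s) (v : unitInterval) : step s v = s :=
  if_pos h

lemma policyA_of_absorbed {s : State} (h : Absorbed s) : policyA s = s := by
  unfold policyA
  rw [if_neg]
  rcases h with h | h <;> omega

lemma measurableSet_white (w t : ℝ) : MeasurableSet {v : unitInterval | (v : ℝ) * t < w} :=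
  measurableSet_lt (measurable_subtype_coe.mul_const t) measurable_const

lemma measurable_step (s : State) : Measurable (step s) := by
  unfold step
  split_ifs
  · exact measurable_const
  · exact Measurable.ite (measurableSet_white _ _) measurable_const measurable_const

lemma measurable_policyA_step (s : State) : Measurable fun v => policyA (step s v) :=
  (Measurable.of_discrete (f := policyA)).comp (measurable_step s)

lemma volume_white {w t : ℝ} (hw : 0 ≤ w) (hwt : w ≤ t) (ht : 0 < t) :
    (volume : Measure unitInterval) {v | (v : ℝ) * t < w} = ENNReal.ofReal (w / t) := by
  have h : {v : unitInterval | (v : ℝ) * t < w}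
      = Set.Iio ⟨w / t, div_nonneg hw ht.le, (div_le_one ht).2 hwt⟩ := by
    ext v
    simp only [Set.mem_ofPred_eq, Set.mem_Iio, ← Subtype.coe_lt_coe]
    rw [lt_div_iff₀ ht]
  rw [h, unitInterval.volume_Iio]

/-- Writing a live state as `(w + 1, b + 1)` keeps truncated subtraction out of all drift
computations. -/
lemma lintegral_step (F : State → ℝ) (hF : ∀ s, 0 ≤ F s) (w b : ℕ) :
    ∫⁻ v, ENNReal.ofReal (F (step (w + 1, b + 1) v)) = ENNReal.ofReal
      ((((w : ℝ) + 1) * F (w + 2, b) + ((b : ℝ) + 1) * F (w, b + 2)) / ((w : ℝ) + b + 2)) := by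
  set t : ℝ := (w : ℝ) + b + 2 with ht
  have ht0 : 0 < t := by positivity
  set S : Set unitInterval := {v | (v : ℝ) * t < (w : ℝ) + 1} with hS
  have hSm : MeasurableSet S := measurableSet_white _ _
  have hvol : volume S = ENNReal.ofReal (((w : ℝ) + 1) / t) :=
    volume_white (by positivity) (by rw [ht]; linarith [(b.cast_nonneg : (0 : ℝ) ≤ b)]) ht0
  have hvolc : volume Sᶜ = ENNReal.ofReal (((b : ℝ) + 1) / t) := by
    rw [prob_compl_eq_one_sub hSm, hvol, ← ENNReal.ofReal_one,
      ← ENNReal.ofReal_sub _ (by positivity)]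
    congr 1
    field_simp
    rw [ht]; ring
  have h1 : ∀ v ∈ S, ENNReal.ofReal (F (step (w + 1, b + 1) v)) = ENNReal.ofReal (F (w + 2, b)) := by
    intro v hv
    have : (v : ℝ) * (((w + 1 : ℕ) : ℝ) + ((b + 1 : ℕ) : ℝ)) < ((w + 1 : ℕ) : ℝ) := by
      have : (v : ℝ) * t < (w : ℝ) + 1 := hv
      push_cast
      rwa [show (w : ℝ) + 1 + (b + 1) = t by rw [ht]; ring]
    simp only [step]
    rw [if_neg (by simp [Absorbed]), if_pos this]
    simp
  have h2 : ∀ v ∈ Sᶜ, ENNReal.ofReal (F (step (w + 1, b + 1) v))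
      = ENNReal.ofReal (F (w, b + 2)) := by
    intro v hv
    have : ¬ (v : ℝ) * (((w + 1 : ℕ) : ℝ) + ((b + 1 : ℕ) : ℝ)) < ((w + 1 : ℕ) : ℝ) := by
      have : ¬ (v : ℝ) * t < (w : ℝ) + 1 := hv
      push_cast
      rwa [show (w : ℝ) + 1 + (b + 1) = t by rw [ht]; ring]
    simp only [step]
    rw [if_neg (by simp [Absorbed]), if_neg this]
    simp
  rw [← lintegral_add_compl _ hSm, setLIntegral_congr_fun hSm h1,
    setLIntegral_congr_fun hSm.compl h2, setLIntegral_const, setLIntegral_const, hvol, hvolc,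
    ← ENNReal.ofReal_mul (hF _), ← ENNReal.ofReal_mul (hF _), ← ENNReal.ofReal_add
      (mul_nonneg (hF _) (by positivity)) (mul_nonneg (hF _) (by positivity))]
  congr 1
  field_simp

lemma exists_succ_of_not_absorbed {s : State} (hs : ¬ Absorbed s) :
    ∃ w b : ℕ, s = (w + 1, b + 1) := by
  obtain ⟨w, b⟩ := s
  obtain ⟨hw, hb⟩ := not_absorbed_iff.1 hs
  exact ⟨w - 1, b - 1, by ext <;> simp <;> omega⟩

lemma T_eq (w b : ℕ) :
    T w b = ∫⁻ u, (absorptionTime (chain step (w, b) u) : ENNReal) ∂drawLaw := by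
  simp_rw [T, mPath_eq_chain]

lemma TA_eq (w b : ℕ) :
    TA w b = ∫⁻ u, (absorptionTime
      (chain (fun r v => policyA (step r v)) (policyA (w, b)) u) : ENNReal) ∂drawLaw := by
  simp_rw [TA, aPath_eq_chain]

lemma policyA_step_of_absorbed (s : State) (v : unitInterval) (h : Absorbed s) :
    policyA (step s v) = s := by
  rw [step_of_absorbed h, policyA_of_absorbed h]

/-- Drift criterion for upper bounds on both expected absorption times. -/
lemma T_TA_le {F : State → ℝ} (hF0 : ∀ s, 0 ≤ F s)
    (hF : ∀ w b : ℕ, (((w : ℝ) + 1) * F (w + 2, b) + ((b : ℝ) + 1) * F (w, b + 2))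
      / ((w : ℝ) + b + 2) + 1 ≤ F (w + 1, b + 1))
    (hpol : ∀ s, F (policyA s) ≤ F s) (w b : ℕ) :
    T w b ≤ ENNReal.ofReal (F (w, b)) ∧ TA w b ≤ ENNReal.ofReal (F (w, b)) := by
  have hstep : ∀ s, ¬ Absorbed s →
      (∫⁻ v, ENNReal.ofReal (F (step s v))) + 1 ≤ ENNReal.ofReal (F s) := by
    intro s hs
    obtain ⟨w, b, rfl⟩ := exists_succ_of_not_absorbed hs
    rw [lintegral_step F hF0, ← ENNReal.ofReal_one, ← ENNReal.ofReal_add _ zero_le_one]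
    · exact ENNReal.ofReal_le_ofReal (hF w b)
    · have := hF0 (w + 2, b)
      have := hF0 (w, b + 2)
      positivity
  constructor
  · rw [T_eq]
    exact lintegral_absorptionTime_le (F := fun s => ENNReal.ofReal (F s)) measurable_step
      (fun s v h => step_of_absorbed h v) hstep _
  · rw [TA_eq]
    refine (lintegral_absorptionTime_le (F := fun s => ENNReal.ofReal (F s))
      measurable_policyA_step policyA_step_of_absorbed (fun s hs => ?_) _).trans
      (ENNReal.ofReal_le_ofReal (hpol _))
    refine le_trans ?_ (hstep s hs)
    gcongr with v
    exact hpol _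

/-- Drift criterion for lower bounds on both expected absorption times. -/
lemma le_T_TA {F : State → ℝ} {M : ℝ} (hF0 : ∀ s, 0 ≤ F s) (hFM : ∀ s, F s ≤ M)
    (hFabs : ∀ s, Absorbed s → F s = 0)
    (hF : ∀ w b : ℕ, F (w + 1, b + 1) ≤ (((w : ℝ) + 1) * F (w + 2, b) + ((b : ℝ) + 1) * F (w, b + 2))
      / ((w : ℝ) + b + 2) + 1)
    (hpol : ∀ s, F s ≤ F (policyA s)) (w b : ℕ) :
    ENNReal.ofReal (F (w, b)) ≤ T w b ∧ ENNReal.ofReal (F (w, b)) ≤ TA w b := by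
  have hstep : ∀ s, ¬ Absorbed s →
      ENNReal.ofReal (F s) ≤ (∫⁻ v, ENNReal.ofReal (F (step s v))) + 1 := by
    intro s hs
    obtain ⟨w, b, rfl⟩ := exists_succ_of_not_absorbed hs
    rw [lintegral_step F hF0, ← ENNReal.ofReal_one, ← ENNReal.ofReal_add _ zero_le_one]
    · exact ENNReal.ofReal_le_ofReal (hF w b)
    · have := hF0 (w + 2, b)
      have := hF0 (w, b + 2)
      positivity
  have hM : ∀ s, ENNReal.ofReal (F s) ≤ ENNReal.ofReal M :=
    fun s => ENNReal.ofReal_le_ofReal (hFM s)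
  have habs : ∀ s, Absorbed s → ENNReal.ofReal (F s) = 0 := fun s hs => by simp [hFabs s hs]
  constructor
  · rw [T_eq]
    exact le_lintegral_absorptionTime (F := fun s => ENNReal.ofReal (F s)) measurable_step
      (fun s v h => step_of_absorbed h v) ENNReal.ofReal_ne_top hM habs hstep _
  · rw [TA_eq]
    refine (ENNReal.ofReal_le_ofReal (hpol _)).trans
      (le_lintegral_absorptionTime (F := fun s => ENNReal.ofReal (F s))
      measurable_policyA_step policyA_step_of_absorbed ENNReal.ofReal_ne_top hM habs
      (fun s hs => ?_) _)
    refine (hstep s hs).trans ?_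
    gcongr with v
    exact hpol _

/-! ### Coincidence of the two processes and the final number of black balls -/

/-- The states in which Policy A removes balls. -/
def policyActs : Set State := {s | s.2 ≤ s.1 ∧ 0 < s.2}

lemma policyA_of_notMem {s : State} (h : s ∉ policyActs) : policyA s = s := if_neg h

/-- Drift criterion for the probability that the uncontrolled process ever reaches a state in which
Policy A removes balls. -/
lemma drawLaw_policyActs_le {F : State → ℝ} (hF0 : ∀ s, 0 ≤ F s)
    (hF1 : ∀ s ∈ policyActs, 1 ≤ F s)
    (hF : ∀ w b : ℕ, (((w : ℝ) + 1) * F (w + 2, b) + ((b : ℝ) + 1) * F (w, b + 2))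
      / ((w : ℝ) + b + 2) ≤ F (w + 1, b + 1)) (s : State) :
    drawLaw {u | ∃ n, mPath s u n ∈ policyActs} ≤ ENNReal.ofReal (F s) := by
  simp_rw [mPath_eq_chain]
  refine drawLaw_exists_mem_le (F := fun s => ENNReal.ofReal (F s)) measurable_step
    (fun s hs => ENNReal.one_le_ofReal.2 (hF1 s hs)) (fun s _ => ?_) s
  by_cases habs : Absorbed s
  · simp [step_of_absorbed habs]
  · obtain ⟨w, b, rfl⟩ := exists_succ_of_not_absorbed habs
    rw [lintegral_step F hF0]
    exact ENNReal.ofReal_le_ofReal (hF w b)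

lemma aPath_eq_mPath {s : State} {u : Draws} (h : ∀ n, mPath s u n ∉ policyActs) (n : ℕ) :
    aPath s u n = mPath s u n := by
  induction n with
  | zero => exact policyA_of_notMem (h 0)
  | succ n ih =>
    rw [aPath, ih]
    exact policyA_of_notMem (h (n + 1))

lemma step_sum (s : State) (v : unitInterval) : (step s v).1 + (step s v).2 = s.1 + s.2 := by
  by_cases habs : Absorbed s
  · rw [step_of_absorbed habs]
  · obtain ⟨w, b, rfl⟩ := exists_succ_of_not_absorbed habs
    simp only [step]
    rw [if_neg habs]
    split_ifs <;> simp <;> omega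

lemma policyA_sum_le (s : State) : (policyA s).1 + (policyA s).2 ≤ s.1 + s.2 := by
  unfold policyA
  split_ifs
  · simp only; omega
  · exact le_rfl

lemma mPath_sum (s : State) (u : Draws) (n : ℕ) :
    (mPath s u n).1 + (mPath s u n).2 = s.1 + s.2 := by
  induction n with
  | zero => rfl
  | succ n ih => rw [mPath, step_sum, ih]

lemma aPath_sum_le (s : State) (u : Draws) (n : ℕ) :
    (aPath s u n).1 + (aPath s u n).2 ≤ s.1 + s.2 := by
  induction n with
  | zero => exact policyA_sum_le s
  | succ n ih => exact (policyA_sum_le _).trans ((step_sum _ _).trans_le ih)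

lemma absorbed_of_absorptionTime_ne_top {p : ℕ → State} (h : absorptionTime p ≠ ⊤) :
    Absorbed (p (absorptionTime p).toNat) := by
  have hne : ((fun n : ℕ => (n : ℕ∞)) '' {n : ℕ | Absorbed (p n)}).Nonempty := by
    by_contra hn
    rw [Set.not_nonempty_iff_eq_empty] at hn
    exact h (by rw [absorptionTime, hn, sInf_empty])
  obtain ⟨n, hn, he⟩ := csInf_mem hne
  have : absorptionTime p = n := he.symm
  rw [this]
  exact hn

/-- The last black ball can be lost only from a live state with one black ball; such a state has a
white ball, so it lies in `policyActs`. -/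
lemma mPath_black_pos {s : State} {u : Draws} (hb : 0 < s.2)
    (h : ∀ n, mPath s u n ∉ policyActs) (n : ℕ) : 0 < (mPath s u n).2 := by
  induction n with
  | zero => exact hb
  | succ n ih =>
    by_cases habs : Absorbed (mPath s u n)
    · rwa [mPath, step_of_absorbed habs]
    · obtain ⟨w, b, hwb⟩ := exists_succ_of_not_absorbed habs
      have hn := h n
      rw [hwb] at habs hn
      simp only [policyActs, Set.mem_ofPred_eq] at hn
      rw [mPath, hwb]
      simp only [step]
      rw [if_neg habs]
      split_ifs
      · simp only; omega
      · exact Nat.succ_pos _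

lemma finalBlack_mPath_eq {s : State} {u : Draws} (hb : 0 < s.2)
    (h : ∀ n, mPath s u n ∉ policyActs) (htop : absorptionTime (mPath s u) ≠ ⊤) :
    finalBlack (mPath s u) = s.1 + s.2 := by
  have habs := absorbed_of_absorptionTime_ne_top htop
  have hsum := mPath_sum s u (absorptionTime (mPath s u)).toNat
  have := mPath_black_pos hb h (absorptionTime (mPath s u)).toNat
  unfold finalBlack
  rcases habs with h0 | h0 <;> omega

section FinalBlack

variable {K : State → unitInterval → State}

lemma ae_absorptionTime_ne_top (hK : ∀ s, Measurable (K s))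
    (hfix : ∀ s v, Absorbed s → K s v = s) {s : State}
    (hT : ∫⁻ u, (absorptionTime (chain K s u) : ENNReal) ∂drawLaw ≠ ⊤) :
    ∀ᵐ u ∂drawLaw, absorptionTime (chain K s u) ≠ ⊤ := by
  rw [lintegral_absorptionTime hK hfix] at hT
  have hlim := ENNReal.tendsto_atTop_zero_of_tsum_ne_top hT
  rw [ae_iff]
  -- Never being absorbed is contained in being alive at each time `n`, an event whose probability
  -- tends to 0.
  refine le_antisymm (ge_of_tendsto' hlim fun n => measure_mono fun u hu hn => ?_) bot_le
  simp only [Set.mem_ofPred_eq, not_not] at hu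
  have h : absorptionTime (chain K s u) ≤ n := sInf_le ⟨n, hn, rfl⟩
  rw [hu] at h
  exact absurd h (by simp)

/-- Almost surely the path is eventually constant, so the final count is an almost sure limit of the
measurable counts at fixed times. -/
lemma aemeasurable_finalBlack (hK : ∀ s, Measurable (K s))
    (hfix : ∀ s v, Absorbed s → K s v = s) {s : State}
    (hT : ∫⁻ u, (absorptionTime (chain K s u) : ENNReal) ∂drawLaw ≠ ⊤) :
    AEMeasurable (fun u => (finalBlack (chain K s u) : ℝ)) drawLaw := by
  refine aemeasurable_of_tendsto_metrizable_ae atTop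
    (f := fun n u => ((chain K s u n).2 : ℝ)) (fun n => ?_) ?_
  · exact ((Measurable.of_discrete (f := fun r : State => (r.2 : ℝ))).comp
      (measurable_chain_right hK s n)).aemeasurable
  · filter_upwards [ae_absorptionTime_ne_top hK hfix hT] with u hu
    refine tendsto_const_nhds.congr' ?_
    filter_upwards [eventually_ge_atTop (absorptionTime (chain K s u)).toNat] with n hn
    have habs := absorbed_of_absorptionTime_ne_top hu
    have : chain K s u n = chain K s u (absorptionTime (chain K s u)).toNat := by
      induction n, hn using Nat.le_induction with
      | base => rfl
      | succ n hn ih => rw [chain, hfix _ _ (by rwa [ih]), ih]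
    rw [this]
    rfl

end FinalBlack

lemma integral_mem_Icc_of_eq_off {X : Draws → ℕ} {N : ℕ} {A : Set Draws} (hA : MeasurableSet A)
    (hX : AEMeasurable (fun u => (X u : ℝ)) drawLaw) (hXN : ∀ u, X u ≤ N)
    (h : ∀ᵐ u ∂drawLaw, u ∉ A → X u = N) :
    ∫ u, (X u : ℝ) ∂drawLaw ∈ Set.Icc ((N : ℝ) * (1 - drawLaw.real A)) N := by
  have hint : Integrable (fun u => (X u : ℝ)) drawLaw := by
    refine Integrable.of_bound hX.aestronglyMeasurable (N : ℝ) (ae_of_all _ fun u => ?_)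
    simpa using hXN u
  constructor
  · have : (N : ℝ) * (1 - drawLaw.real A) = ∫ u, Aᶜ.indicator (fun _ => (N : ℝ)) u ∂drawLaw := by
      rw [integral_indicator hA.compl, setIntegral_const, probReal_compl_eq_one_sub hA,
        smul_eq_mul, mul_comm]
    rw [this]
    refine integral_mono_ae ((integrable_const _).indicator hA.compl) hint ?_
    filter_upwards [h] with u hu
    by_cases huA : u ∈ A
    · simp [huA]
    · simp [huA, hu huA]
  · calc ∫ u, (X u : ℝ) ∂drawLaw ≤ ∫ _, (N : ℝ) ∂drawLaw :=
          integral_mono hint (integrable_const _) fun u => Nat.cast_le.2 (hXN u)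
      _ = N := by simp

lemma measurableSet_exists_policyActs (s : State) :
    MeasurableSet {u | ∃ n, mPath s u n ∈ policyActs} := by
  have : {u | ∃ n, mPath s u n ∈ policyActs}
      = ⋃ n, (fun u => chain step s u n) ⁻¹' policyActs := by
    ext u
    simp [mPath_eq_chain]
  rw [this]
  exact MeasurableSet.iUnion fun n =>
    measurable_chain_right measurable_step s n MeasurableSet.of_discrete

/-- Both expected final numbers of black balls are close to the total number of balls when
Policy A is unlikely ever to act. -/
lemma V_VA_mem_Icc {w b : ℕ} (hb : 0 < b) (hT : T w b ≠ ⊤) (hTA : TA w b ≠ ⊤) :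
    V w b ∈ Set.Icc
      (((w + b : ℕ) : ℝ) * (1 - drawLaw.real {u | ∃ n, mPath (w, b) u n ∈ policyActs}))
      ((w + b : ℕ) : ℝ) ∧
    VA w b ∈ Set.Icc
      (((w + b : ℕ) : ℝ) * (1 - drawLaw.real {u | ∃ n, mPath (w, b) u n ∈ policyActs}))
      ((w + b : ℕ) : ℝ) := by
  rw [T_eq] at hT
  rw [TA_eq] at hTA
  have hae : ∀ᵐ u ∂drawLaw, absorptionTime (mPath (w, b) u) ≠ ⊤ := by
    simp_rw [mPath_eq_chain]
    exact ae_absorptionTime_ne_top measurable_step (fun s v h => step_of_absorbed h v) hT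
  have hm := measurableSet_exists_policyActs (w, b)
  constructor
  · refine integral_mem_Icc_of_eq_off hm ?_ (fun u => ?_) ?_
    · simp_rw [mPath_eq_chain]
      exact aemeasurable_finalBlack measurable_step (fun s v h => step_of_absorbed h v) hT
    · have := mPath_sum (w, b) u (absorptionTime (mPath (w, b) u)).toNat
      simp only [finalBlack]
      omega
    · filter_upwards [hae] with u hu hG
      exact finalBlack_mPath_eq hb (not_exists.1 hG) hu
  · refine integral_mem_Icc_of_eq_off hm ?_ (fun u => ?_) ?_
    · simp_rw [aPath_eq_chain]
      exact aemeasurable_finalBlack measurable_policyA_step policyA_step_of_absorbed hTA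
    · have := aPath_sum_le (w, b) u (absorptionTime (aPath (w, b) u)).toNat
      simp only [finalBlack]
      omega
    · filter_upwards [hae] with u hu hG
      rw [show aPath (w, b) u = mPath (w, b) u from funext (aPath_eq_mPath (not_exists.1 hG))]
      exact finalBlack_mPath_eq hb (not_exists.1 hG) hu

/-! ### The product `wb`: finiteness of the expected times -/

/-- For a live state with `w'` white and `b'` black balls, the mean change of the product is exactly
`-1 - (b' - w')²/(w' + b')`. -/
lemma mul_drift (w b : ℕ) :
    (((w : ℝ) + 1) * (((w + 2 : ℕ) : ℝ) * b) + ((b : ℝ) + 1) * ((w : ℝ) * ((b + 2 : ℕ) : ℝ)))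
      / ((w : ℝ) + b + 2) + 1 ≤ ((w + 1 : ℕ) : ℝ) * ((b + 1 : ℕ) : ℝ) := by
  have h : (0 : ℝ) < (w : ℝ) + b + 2 := by positivity
  rw [← le_sub_iff_add_le, div_le_iff₀ h]
  push_cast
  nlinarith [sq_nonneg ((b : ℝ) - w)]

lemma policyA_mul_le (s : State) : ((policyA s).1 : ℝ) * (policyA s).2 ≤ (s.1 : ℝ) * s.2 := by
  unfold policyA
  split_ifs with h
  · have : s.2 - 1 ≤ s.1 := by omega
    gcongr
  · exact le_rfl

lemma T_TA_le_mul (w b : ℕ) :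
    T w b ≤ ENNReal.ofReal ((w : ℝ) * b) ∧ TA w b ≤ ENNReal.ofReal ((w : ℝ) * b) :=
  T_TA_le (F := fun s => (s.1 : ℝ) * s.2) (fun s => by positivity) mul_drift policyA_mul_le w b

lemma T_ne_top (w b : ℕ) : T w b ≠ ⊤ := ne_top_of_le_ne_top ENNReal.ofReal_ne_top (T_TA_le_mul w b).1

lemma TA_ne_top (w b : ℕ) : TA w b ≠ ⊤ :=
  ne_top_of_le_ne_top ENNReal.ofReal_ne_top (T_TA_le_mul w b).2

/-! ### Drift of the barrier and of the fluid-limit time -/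

/-- The exponential barrier for an urn with `N` balls. -/
def barrier (ρ N : ℝ) (w : ℕ) : ℝ := ρ ^ ((w : ℝ) - N / (1 + ρ))

/-- The fluid-limit approximation of the expected absorption time. -/
def fluidTime (s : State) : ℝ :=
  ((s.1 : ℝ) + s.2) / 2 * Real.log (((s.1 : ℝ) + s.2) / ((s.2 : ℝ) - s.1))

lemma barrier_pos {ρ : ℝ} (hρ : 1 < ρ) (N : ℝ) (w : ℕ) : 0 < barrier ρ N w :=
  Real.rpow_pos_of_pos (by linarith) _

/-- The exponent vanishes exactly on the line `ρw = b` and is positive on its white side. -/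
lemma one_le_barrier {ρ : ℝ} (hρ : 1 < ρ) {w b : ℕ} {N : ℝ} (hN : (w : ℝ) + b = N)
    (h : ¬ ρ * w ≤ b) : 1 ≤ barrier ρ N w := by
  refine Real.one_le_rpow hρ.le ?_
  rw [sub_nonneg, div_le_iff₀ (by linarith)]
  push Not at h
  linarith

/-- After division by `barrier ρ N w` the claim is `(ρ - 1)(ρ(w + 1) - (b + 1)) ≤ 0`. -/
lemma barrier_drift {ρ : ℝ} (hρ : 1 < ρ) (N : ℝ) {w b : ℕ}
    (h : ρ * ((w : ℝ) + 1) ≤ (b : ℝ) + 1) :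
    (((w : ℝ) + 1) * barrier ρ N (w + 2) + ((b : ℝ) + 1) * barrier ρ N w) / ((w : ℝ) + b + 2)
      ≤ barrier ρ N (w + 1) := by
  have hρ0 : 0 < ρ := by linarith
  have h0 := barrier_pos hρ N w
  have h1 : barrier ρ N (w + 1) = ρ * barrier ρ N w := by
    unfold barrier
    rw [mul_comm, ← Real.rpow_add_one hρ0.ne']
    congr 1; push_cast; ring
  have h2 : barrier ρ N (w + 2) = ρ ^ 2 * barrier ρ N w := by
    rw [pow_two, mul_assoc, ← h1]
    unfold barrier
    rw [mul_comm, ← Real.rpow_add_one hρ0.ne']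
    congr 1; push_cast; ring
  rw [div_le_iff₀ (by positivity), h1, h2]
  nlinarith [mul_nonneg (mul_nonneg h0.le (sub_nonneg.2 hρ.le)) (sub_nonneg.2 h)]

lemma log_sub_le {D t : ℝ} (hD : 0 < D) (ht : 0 < D + t) :
    Real.log (D + t) ≤ Real.log D + t / D := by
  have := Real.log_le_sub_one_of_pos (div_pos ht hD)
  rw [Real.log_div ht.ne' hD.ne', add_div, div_self hD.ne'] at this
  linarith

/-- With `s = t/D` this is `ln(1 + s) ≥ s - 2s²` for `s ≥ -1/2`, from `ln y ≥ 1 - 1/y`. The range of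
`s` is why the case `t = -2` later needs `D ≥ 4`. -/
lemma le_log_add {D t : ℝ} (hD : 0 < D) (ht : 0 ≤ D + 2 * t) :
    Real.log D + t / D - 2 * (t / D) ^ 2 ≤ Real.log (D + t) := by
  have hDt : 0 < D + t := by linarith
  have h1 := Real.one_sub_inv_le_log_of_pos (div_pos hDt hD)
  rw [Real.log_div hDt.ne' hD.ne', inv_div] at h1
  have h2 : t / D - 2 * (t / D) ^ 2 ≤ 1 - D / (D + t) := by
    have : 1 - D / (D + t) - (t / D - 2 * (t / D) ^ 2) = t ^ 2 * (D + 2 * t) / (D ^ 2 * (D + t)) := by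
      field_simp
      ring
    have : 0 ≤ t ^ 2 * (D + 2 * t) / (D ^ 2 * (D + t)) := by positivity
    linarith
  linarith

lemma fluidTime_eq {w b : ℕ} (h : w < b) : fluidTime (w, b) = ((w : ℝ) + b) / 2 *
    (Real.log ((w : ℝ) + b) - Real.log ((b : ℝ) - w)) := by
  have h1 : (0 : ℝ) < (b : ℝ) - w := sub_pos.2 (Nat.cast_lt.2 h)
  have h2 : (0 : ℝ) < (w : ℝ) + b := by linarith [(w.cast_nonneg : (0 : ℝ) ≤ w)]
  rw [fluidTime, Real.log_div h2.ne' h1.ne']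

/-- The tangent line of the concave logarithm at `D` bounds `ln(D ± 2)` from above, and its linear
term averages to the drift `2/N` of `ln D`. The prefactor `N/2` turns this into 1. -/
lemma fluidTime_le_drift {w b : ℕ} (h : w + 4 ≤ b) :
    fluidTime (w + 1, b + 1) ≤ (((w : ℝ) + 1) * fluidTime (w + 2, b)
      + ((b : ℝ) + 1) * fluidTime (w, b + 2)) / ((w : ℝ) + b + 2) + 1 := by
  rw [fluidTime_eq (by omega), fluidTime_eq (by omega), fluidTime_eq (by omega)]
  have hbw : (w : ℝ) + 4 ≤ b := by exact_mod_cast h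
  obtain ⟨D, hD⟩ : ∃ D : ℝ, D = b - w := ⟨_, rfl⟩
  have hb : (b : ℝ) = w + D := by linarith
  have hw : (0 : ℝ) ≤ w := w.cast_nonneg
  have h1 := log_sub_le (D := D) (t := 2) (by linarith) (by linarith)
  have h2 := log_sub_le (D := D) (t := -2) (by linarith) (by linarith)
  push_cast
  rw [hb]
  rw [show (w : ℝ) + D + 1 - (w + 1) = D by ring, show (w : ℝ) + D + 2 - w = D + 2 by ring,
    show (w : ℝ) + D - (w + 2) = D + -2 by ring, show (w : ℝ) + 1 + (w + D + 1) = 2 * w + D + 2 by ring,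
    show (w : ℝ) + 2 + (w + D) = 2 * w + D + 2 by ring,
    show (w : ℝ) + (w + D + 2) = 2 * w + D + 2 by ring,
    show (w : ℝ) + (w + D) + 2 = 2 * w + D + 2 by ring]
  have hN : 0 < 2 * (w : ℝ) + D + 2 := by linarith
  set N := 2 * (w : ℝ) + D + 2
  set L := Real.log N
  rw [← sub_le_iff_le_add, le_div_iff₀ hN]
  have e : (w + D + 1) * (2 / D) + (w + 1) * (-2 / D) = 2 := by
    have hD0 : D ≠ 0 := by linarith
    field_simp; ring
  have k1 := mul_le_mul_of_nonneg_left h1 (show 0 ≤ (w : ℝ) + D + 1 by linarith)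
  have k2 := mul_le_mul_of_nonneg_left h2 (show 0 ≤ (w : ℝ) + 1 by linarith)
  have k : (w + D + 1) * Real.log (D + 2) + (w + 1) * Real.log (D + -2) ≤ N * Real.log D + 2 := by
    calc _ ≤ _ := add_le_add k1 k2
      _ = N * Real.log D + ((w + D + 1) * (2 / D) + (w + 1) * (-2 / D)) := by
        simp only [N]; ring
      _ = _ := by rw [e]
  have k3 := mul_le_mul_of_nonneg_left k (show 0 ≤ N / 2 by linarith)
  have hNe : N = (w + 1) + (w + D + 1) := by simp only [N]; ring
  have : ((w : ℝ) + 1) * (N / 2 * (L - Real.log (D + -2))) + (w + D + 1) * (N / 2 * (L - Real.log (D + 2)))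
      = N / 2 * (N * L) - N / 2 * ((w + D + 1) * Real.log (D + 2) + (w + 1) * Real.log (D + -2)) := by
    rw [show N / 2 * (N * L) = N / 2 * (((w + 1) + (w + D + 1)) * L) by rw [← hNe]]; ring
  rw [this]
  linarith

/-- The quadratic error `2(2/D)²` in the logarithm, times the prefactor `N/2`, gives the loss
`4N/D²`. -/
lemma fluidTime_drift_le {w b : ℕ} (h : w + 4 ≤ b) :
    (((w : ℝ) + 1) * fluidTime (w + 2, b)
      + ((b : ℝ) + 1) * fluidTime (w, b + 2)) / ((w : ℝ) + b + 2)
      + (1 - 4 * ((w : ℝ) + b + 2) / ((b : ℝ) - w) ^ 2) ≤ fluidTime (w + 1, b + 1) := by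
  rw [fluidTime_eq (by omega), fluidTime_eq (by omega), fluidTime_eq (by omega)]
  have hbw : (w : ℝ) + 4 ≤ b := by exact_mod_cast h
  obtain ⟨D, hD⟩ : ∃ D : ℝ, D = b - w := ⟨_, rfl⟩
  have hb : (b : ℝ) = w + D := by linarith
  have hw : (0 : ℝ) ≤ w := w.cast_nonneg
  have h1 := le_log_add (D := D) (t := 2) (by linarith) (by linarith)
  have h2 := le_log_add (D := D) (t := -2) (by linarith) (by linarith)
  push_cast
  rw [hb]
  rw [show (w : ℝ) + D + 1 - (w + 1) = D by ring, show (w : ℝ) + D + 2 - w = D + 2 by ring,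
    show (w : ℝ) + D - (w + 2) = D + -2 by ring, show (w : ℝ) + 1 + (w + D + 1) = 2 * w + D + 2 by ring,
    show (w : ℝ) + 2 + (w + D) = 2 * w + D + 2 by ring,
    show (w : ℝ) + (w + D + 2) = 2 * w + D + 2 by ring,
    show (w : ℝ) + (w + D) + 2 = 2 * w + D + 2 by ring, show (w : ℝ) + D - w = D by ring]
  have hN : 0 < 2 * (w : ℝ) + D + 2 := by linarith
  set N := 2 * (w : ℝ) + D + 2
  set L := Real.log N
  have hD0 : D ≠ 0 := by linarith
  rw [← le_sub_iff_add_le, div_le_iff₀ hN]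
  have e : (w + D + 1) * (2 / D - 2 * (2 / D) ^ 2) + (w + 1) * (-2 / D - 2 * (-2 / D) ^ 2)
      = 2 - 8 * N / D ^ 2 := by
    simp only [N]; field_simp; ring
  have k1 := mul_le_mul_of_nonneg_left h1 (show 0 ≤ (w : ℝ) + D + 1 by linarith)
  have k2 := mul_le_mul_of_nonneg_left h2 (show 0 ≤ (w : ℝ) + 1 by linarith)
  have k : N * Real.log D + (2 - 8 * N / D ^ 2)
      ≤ (w + D + 1) * Real.log (D + 2) + (w + 1) * Real.log (D + -2) := by
    calc _ = N * Real.log D + ((w + D + 1) * (2 / D - 2 * (2 / D) ^ 2)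
          + (w + 1) * (-2 / D - 2 * (-2 / D) ^ 2)) := by rw [e]
      _ = _ := by simp only [N]; ring
      _ ≤ _ := add_le_add k1 k2
  have k3 := mul_le_mul_of_nonneg_left k (show 0 ≤ N / 2 by linarith)
  have hNe : N = (w + 1) + (w + D + 1) := by simp only [N]; ring
  have : ((w : ℝ) + 1) * (N / 2 * (L - Real.log (D + -2))) + (w + D + 1) * (N / 2 * (L - Real.log (D + 2)))
      = N / 2 * (N * L) - N / 2 * ((w + D + 1) * Real.log (D + 2) + (w + 1) * Real.log (D + -2)) := by
    rw [show N / 2 * (N * L) = N / 2 * (((w + 1) + (w + D + 1)) * L) by rw [← hNe]]; ring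
  rw [this]
  have e2 : N / 2 * (2 - 8 * N / D ^ 2) = N * (1 - 4 * N / D ^ 2) := by ring
  linarith

/-- Also true when white balls are at least as many, since the real logarithm depends on `|D|` only
and gives 0 at `D = 0`. -/
lemma fluidTime_nonneg (s : State) : 0 ≤ fluidTime s := by
  refine mul_nonneg (by positivity) ?_
  have h1 : (0 : ℝ) ≤ s.1 := Nat.cast_nonneg _
  have h2 : (0 : ℝ) ≤ s.2 := Nat.cast_nonneg _
  rcases eq_or_ne ((s.2 : ℝ) - s.1) 0 with h | h
  · simp [h]
  · rw [← Real.log_abs]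
    refine Real.log_nonneg ?_
    rw [abs_div, one_le_div (abs_pos.2 h), abs_of_nonneg (add_nonneg h1 h2)]
    exact abs_le.2 ⟨by linarith, by linarith⟩

lemma fluidTime_le_sq (s : State) : fluidTime s ≤ ((s.1 : ℝ) + s.2) ^ 2 := by
  have h1 : (0 : ℝ) ≤ (s.1 : ℝ) + s.2 := by positivity
  have hlog : Real.log (((s.1 : ℝ) + s.2) / ((s.2 : ℝ) - s.1)) ≤ (s.1 : ℝ) + s.2 := by
    rcases eq_or_ne ((s.2 : ℝ) - s.1) 0 with h | h
    · simpa [h] using h1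
    -- A nonzero integer difference has absolute value at least one, which keeps the quotient at
    -- most `N`.
    · have hint : (1 : ℝ) ≤ |(s.2 : ℝ) - s.1| := by
        have : ((s.2 : ℤ) - s.1) ≠ 0 := by exact_mod_cast h
        exact_mod_cast Int.one_le_abs this
      rw [← Real.log_abs, abs_div, abs_of_nonneg h1]
      exact (Real.log_le_self (by positivity)).trans (div_le_self h1 hint)
  rw [fluidTime, pow_two]
  calc _ ≤ ((s.1 : ℝ) + s.2) / 2 * ((s.1 : ℝ) + s.2) := by gcongr
    _ ≤ _ := by nlinarith

/-! ### Test functions glued along the boundary of the black region -/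

/-- The states with `N` balls in which the black balls outnumber the white ones by the factor `ρ`. -/
def blackRegion (ρ : ℝ) (N : ℕ) : Set State := {s | s.1 + s.2 = N ∧ ρ * s.1 ≤ s.2}

lemma notMem_blackRegion_of_policyActs {ρ : ℝ} (hρ : 1 < ρ) (N : ℕ) {s : State}
    (hs : s ∈ policyActs) : s ∉ blackRegion ρ N := by
  rintro ⟨-, h⟩
  have h1 : (s.2 : ℝ) ≤ s.1 := Nat.cast_le.2 hs.1
  have h2 : (0 : ℝ) < s.2 := Nat.cast_pos.2 hs.2
  nlinarith

lemma one_le_barrier_of_notMem {ρ : ℝ} (hρ : 1 < ρ) {N : ℕ} {s : State} (hN : s.1 + s.2 = N)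
    (hs : s ∉ blackRegion ρ N) : 1 ≤ barrier ρ N s.1 :=
  one_le_barrier hρ (b := s.2) (by exact_mod_cast hN) fun h => hs ⟨hN, h⟩

lemma sub_ge_of_mem_blackRegion {ρ : ℝ} (hρ : 1 < ρ) {N : ℕ} {s : State}
    (hs : s ∈ blackRegion ρ N) : (ρ - 1) / (ρ + 1) * N ≤ (s.2 : ℝ) - s.1 := by
  obtain ⟨h1, h2⟩ := hs
  have h3 : (N : ℝ) = s.1 + s.2 := by exact_mod_cast h1.symm
  rw [div_mul_eq_mul_div, div_le_iff₀ (by linarith), h3]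
  nlinarith

/-- Averages over the two possible draws are monotone. -/
lemma average_le_average {w b : ℕ} {x x' y y' : ℝ} (hx : x ≤ x') (hy : y ≤ y') :
    (((w : ℝ) + 1) * x + ((b : ℝ) + 1) * y) / ((w : ℝ) + b + 2)
      ≤ (((w : ℝ) + 1) * x' + ((b : ℝ) + 1) * y') / ((w : ℝ) + b + 2) := by
  gcongr

/-- The barrier bounds the probability that Policy A ever acts. -/
lemma drawLaw_policyActs_le_barrier {ρ : ℝ} (hρ : 1 < ρ) {w b : ℕ} :
    drawLaw {u | ∃ n, mPath (w, b) u n ∈ policyActs}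
      ≤ ENNReal.ofReal (barrier ρ ((w + b : ℕ) : ℝ) w) := by
  classical
  set N := w + b with hN
  -- A minimum of two supersolutions is a supersolution. Since `barrier` is at least 1 off the
  -- region, `F ≤ barrier` also holds at neighbours outside it.
  set F : State → ℝ := fun s => if s ∈ blackRegion ρ N then min (barrier ρ N s.1) 1 else 1 with hF
  have hF1 : ∀ s, F s ≤ 1 := fun s => by
    simp only [hF]; split_ifs
    exacts [min_le_right _ _, le_rfl]
  have hFb : ∀ s : State, s.1 + s.2 = N → F s ≤ barrier ρ N s.1 := fun s hs => by
    simp only [hF]; split_ifs with h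
    exacts [min_le_left _ _, one_le_barrier_of_notMem hρ hs h]
  have hF0 : ∀ s, 0 ≤ F s := fun s => by
    simp only [hF]; split_ifs
    exacts [le_min (barrier_pos hρ _ _).le zero_le_one, zero_le_one]
  refine (drawLaw_policyActs_le hF0 (fun s hs => ?_) (fun w b => ?_) (w, b)).trans
    (ENNReal.ofReal_le_ofReal (hFb _ rfl))
  · simp only [hF]
    rw [if_neg (notMem_blackRegion_of_policyActs hρ N hs)]
  · have hone : (((w : ℝ) + 1) * F (w + 2, b) + ((b : ℝ) + 1) * F (w, b + 2))
        / ((w : ℝ) + b + 2) ≤ 1 := by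
      refine (average_le_average (hF1 _) (hF1 _)).trans (le_of_eq ?_)
      field_simp
      ring
    change _ ≤ if ((w + 1, b + 1) : State) ∈ blackRegion ρ N then min (barrier ρ N (w + 1)) 1 else 1
    split_ifs with hR
    · refine le_min ?_ hone
      refine (average_le_average (hFb (w + 2, b) ?_) (hFb (w, b + 2) ?_)).trans
        (barrier_drift hρ N ?_)
      · have := hR.1; simp only at this ⊢; omega
      · have := hR.1; simp only at this ⊢; omega
      · simpa using hR.2
    · exact hone

/-- In the region `D ≥ δN` with `δ = (ρ - 1)/(ρ + 1) ≤ 1`; hence `δ²N > 4` forces `D > 4`, and the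
loss `4N/D²` is at most `4/(δ²N)`. -/
lemma four_le_of_mem_blackRegion {ρ : ℝ} (hρ : 1 < ρ) {N : ℕ}
    (hN : 4 < ((ρ - 1) / (ρ + 1)) ^ 2 * N) {w b : ℕ} (hs : ((w, b) : State) ∈ blackRegion ρ N) :
    w + 4 ≤ b ∧ 4 * (N : ℝ) / ((b : ℝ) - w) ^ 2 ≤ 4 / (((ρ - 1) / (ρ + 1)) ^ 2 * N) := by
  have hsub := sub_ge_of_mem_blackRegion hρ hs
  simp only at hsub
  set δ := (ρ - 1) / (ρ + 1) with hδ
  have hδ0 : 0 < δ := div_pos (by linarith) (by linarith)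
  have hδ1 : δ ≤ 1 := by rw [hδ, div_le_one (by linarith)]; linarith
  have hN0 : (0 : ℝ) < N := by
    by_contra h
    nlinarith [sq_nonneg δ]
  have h4 : 4 < δ * N := hN.trans_le (by nlinarith [mul_pos hδ0 hN0])
  refine ⟨?_, ?_⟩
  · have : (w : ℝ) + 4 ≤ b := by linarith
    exact_mod_cast this
  · have hD : 0 < (b : ℝ) - w := by linarith
    rw [div_le_div_iff₀ (by positivity) (by positivity)]
    nlinarith [pow_le_pow_left₀ (by positivity) hsub 2]

/-- Both expected absorption times are at least the fluid-limit time, up to a small error. -/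
lemma fluidTime_sub_le_T_TA {ρ : ℝ} (hρ : 1 < ρ) {w b : ℕ}
    (hN : 4 < ((ρ - 1) / (ρ + 1)) ^ 2 * ((w + b : ℕ) : ℝ)) :
    ENNReal.ofReal (fluidTime (w, b) - ((w + b : ℕ) : ℝ) ^ 2 * barrier ρ ((w + b : ℕ) : ℝ) w)
      ≤ T w b ∧
    ENNReal.ofReal (fluidTime (w, b) - ((w + b : ℕ) : ℝ) ^ 2 * barrier ρ ((w + b : ℕ) : ℝ) w)
      ≤ TA w b := by
  classical
  obtain ⟨N, hwb⟩ : ∃ N, N = w + b := ⟨_, rfl⟩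
  rw [← hwb] at hN ⊢
  set g : State → ℝ := fun s => fluidTime s - (N : ℝ) ^ 2 * barrier ρ N s.1 with hg
  -- The value 0 off the region makes `F` indifferent to Policy A's removals. Subtracting `N² ·
  -- barrier` makes `g ≤ 0` there, because `fluidTime ≤ N²`, so `g ≤ F` also holds at neighbours
  -- across the boundary.
  set F : State → ℝ := fun s => if s ∈ blackRegion ρ N then max (g s) 0 else 0 with hF
  have hF0 : ∀ s, 0 ≤ F s := fun s => by
    simp only [hF]; split_ifs
    exacts [le_max_right _ _, le_rfl]
  have hbar : ∀ w, 0 ≤ (N : ℝ) ^ 2 * barrier ρ N w :=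
    fun w => mul_nonneg (sq_nonneg _) (barrier_pos hρ _ _).le
  have hfl : ∀ s : State, s.1 + s.2 = N → fluidTime s ≤ (N : ℝ) ^ 2 := fun s hs => by
    have := fluidTime_le_sq s
    rwa [show (s.1 : ℝ) + s.2 = N by exact_mod_cast hs] at this
  have hgF : ∀ s : State, s.1 + s.2 = N → g s ≤ F s := fun s hs => by
    simp only [hF]; split_ifs with hR
    · exact le_max_left _ _
    · have h1 := one_le_barrier_of_notMem hρ hs hR
      have h2 := hfl s hs
      simp only [hg]
      nlinarith [sq_nonneg (N : ℝ)]
  have hFM : ∀ s, F s ≤ (N : ℝ) ^ 2 := fun s => by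
    simp only [hF]; split_ifs with hR
    · exact max_le (by have := hfl s hR.1; have := hbar s.1; simp only [hg]; linarith) (sq_nonneg _)
    · exact sq_nonneg _
  have hFabs : ∀ s, Absorbed s → F s = 0 := fun s hs => by
    simp only [hF]; split_ifs with hR
    · have hs1 : s.1 = 0 := by
        rcases hs with h0 | h0
        · exact h0
        · have h2 := hR.2
          rw [h0] at h2
          by_contra hne
          have : (0 : ℝ) < s.1 := Nat.cast_pos.2 (Nat.pos_of_ne_zero hne)
          simp only [Nat.cast_zero] at h2
          nlinarith
      have : fluidTime s = 0 := by
        rcases eq_or_ne (s.2 : ℝ) 0 with h0 | h0 <;> simp [fluidTime, hs1, h0]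
      refine max_eq_right ?_
      have := hbar s.1
      simp only [hg]; linarith
    · rfl
  have hpol : ∀ s, F s ≤ F (policyA s) := fun s => by
    by_cases hs : s ∈ policyActs
    · simp only [hF]
      rw [if_neg (notMem_blackRegion_of_policyActs hρ N hs)]
      exact hF0 _
    · rw [policyA_of_notMem hs]
  have hdrift : ∀ w b : ℕ, F (w + 1, b + 1) ≤ (((w : ℝ) + 1) * F (w + 2, b)
      + ((b : ℝ) + 1) * F (w, b + 2)) / ((w : ℝ) + b + 2) + 1 := by
    intro w b
    have hpos : 0 ≤ (((w : ℝ) + 1) * F (w + 2, b) + ((b : ℝ) + 1) * F (w, b + 2))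
        / ((w : ℝ) + b + 2) + 1 := by
      have := hF0 (w + 2, b)
      have := hF0 (w, b + 2)
      positivity
    by_cases hR : ((w + 1, b + 1) : State) ∈ blackRegion ρ N
    · have hsum : w + b + 2 = N := by have := hR.1; simp only at this; omega
      have h4 := (four_le_of_mem_blackRegion hρ hN hR).1
      have hval : F (w + 1, b + 1) = max (g (w + 1, b + 1)) 0 := if_pos hR
      rw [hval]
      refine max_le ?_ hpos
      have h1 := fluidTime_le_drift (w := w) (b := b) (by omega)
      have h2 := barrier_drift hρ (N : ℝ) (w := w) (b := b) (by simpa using hR.2)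
      have h3 := average_le_average (w := w) (b := b) (hgF (w + 2, b) (by simp only; omega))
        (hgF (w, b + 2) (by simp only; omega))
      have h2' := mul_le_mul_of_nonneg_left h2 (sq_nonneg (N : ℝ))
      have e : (((w : ℝ) + 1) * g (w + 2, b) + ((b : ℝ) + 1) * g (w, b + 2)) / ((w : ℝ) + b + 2)
          = (((w : ℝ) + 1) * fluidTime (w + 2, b) + ((b : ℝ) + 1) * fluidTime (w, b + 2))
            / ((w : ℝ) + b + 2) - (N : ℝ) ^ 2 * ((((w : ℝ) + 1) * barrier ρ N (w + 2)
            + ((b : ℝ) + 1) * barrier ρ N w) / ((w : ℝ) + b + 2)) := by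
        simp only [hg]; ring
      have e2 : g (w + 1, b + 1) = fluidTime (w + 1, b + 1) - (N : ℝ) ^ 2 * barrier ρ N (w + 1) := rfl
      linarith
    · have hval : F (w + 1, b + 1) = 0 := if_neg hR
      rw [hval]
      exact hpos
  have hle := le_T_TA hF0 hFM hFabs hdrift hpol w b
  have hg' := ENNReal.ofReal_le_ofReal (hgF (w, b) hwb.symm)
  exact ⟨hg'.trans hle.1, hg'.trans hle.2⟩

/-- Both expected absorption times are at most the fluid-limit time, up to a small error. -/
lemma T_TA_le_fluidTime_add {ρ : ℝ} (hρ : 1 < ρ) {w b : ℕ}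
    (hN : 4 < ((ρ - 1) / (ρ + 1)) ^ 2 * ((w + b : ℕ) : ℝ)) :
    T w b ≤ ENNReal.ofReal
      ((1 - 4 / (((ρ - 1) / (ρ + 1)) ^ 2 * ((w + b : ℕ) : ℝ)))⁻¹ * fluidTime (w, b)
        + ((w + b : ℕ) : ℝ) ^ 2 * barrier ρ ((w + b : ℕ) : ℝ) w) ∧
    TA w b ≤ ENNReal.ofReal
      ((1 - 4 / (((ρ - 1) / (ρ + 1)) ^ 2 * ((w + b : ℕ) : ℝ)))⁻¹ * fluidTime (w, b)
        + ((w + b : ℕ) : ℝ) ^ 2 * barrier ρ ((w + b : ℕ) : ℝ) w) := by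
  classical
  obtain ⟨N, hwb⟩ : ∃ N, N = w + b := ⟨_, rfl⟩
  rw [← hwb] at hN ⊢
  -- `c` is the guaranteed mean drop of `fluidTime` in the region; dividing by it restores a drop of
  -- at least one.
  obtain ⟨c, hc⟩ : ∃ c, c = 1 - 4 / (((ρ - 1) / (ρ + 1)) ^ 2 * (N : ℝ)) := ⟨_, rfl⟩
  rw [← hc]
  have hc0 : 0 < c := by
    rw [hc, sub_pos, div_lt_one (by linarith)]
    exact hN
  set g : State → ℝ := fun s => c⁻¹ * fluidTime s + (N : ℝ) ^ 2 * barrier ρ N s.1 with hg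
  set m : State → ℝ := fun s => (s.1 : ℝ) * s.2 with hm
  -- Off the region the product takes over: it has the required drift and Policy A does not increase
  -- it. As it is at most `N²`, the added barrier term gives `F ≤ g` there.
  set F : State → ℝ := fun s => if s ∈ blackRegion ρ N then min (g s) (m s) else m s with hF
  have hbar : ∀ w, 0 ≤ (N : ℝ) ^ 2 * barrier ρ N w :=
    fun w => mul_nonneg (sq_nonneg _) (barrier_pos hρ _ _).le
  have hfl : ∀ s, 0 ≤ c⁻¹ * fluidTime s :=
    fun s => mul_nonneg (inv_pos.2 hc0).le (fluidTime_nonneg s)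
  have hm0 : ∀ s, 0 ≤ m s := fun s => by simp only [hm]; positivity
  have hF0 : ∀ s, 0 ≤ F s := fun s => by
    simp only [hF]; split_ifs
    exacts [le_min (add_nonneg (hfl s) (hbar _)) (hm0 s), hm0 s]
  have hFm : ∀ s, F s ≤ m s := fun s => by
    simp only [hF]; split_ifs
    exacts [min_le_right _ _, le_rfl]
  have hFg : ∀ s : State, s.1 + s.2 = N → F s ≤ g s := fun s hs => by
    simp only [hF]; split_ifs with hR
    · exact min_le_left _ _
    · have h1 := one_le_barrier_of_notMem hρ hs hR
      have h2 := hfl s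
      have h3 : (s.1 : ℝ) + s.2 = N := by exact_mod_cast hs
      have h4 : m s ≤ (N : ℝ) ^ 2 := by
        rw [← h3]; simp only [hm]
        nlinarith [hm0 s, sq_nonneg (s.1 : ℝ), sq_nonneg (s.2 : ℝ)]
      simp only [hg]
      nlinarith [sq_nonneg (N : ℝ)]
  have hpol : ∀ s, F (policyA s) ≤ F s := fun s => by
    by_cases hs : s ∈ policyActs
    · have : F s = m s := if_neg (notMem_blackRegion_of_policyActs hρ N hs)
      rw [this]
      exact (hFm _).trans (policyA_mul_le s)
    · rw [policyA_of_notMem hs]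
  have hdrift : ∀ w b : ℕ, (((w : ℝ) + 1) * F (w + 2, b)
      + ((b : ℝ) + 1) * F (w, b + 2)) / ((w : ℝ) + b + 2) + 1 ≤ F (w + 1, b + 1) := by
    intro w b
    have hmd : (((w : ℝ) + 1) * F (w + 2, b) + ((b : ℝ) + 1) * F (w, b + 2))
        / ((w : ℝ) + b + 2) + 1 ≤ m (w + 1, b + 1) :=
      (add_le_add_left (average_le_average (hFm _) (hFm _)) 1).trans (mul_drift w b)
    by_cases hR : ((w + 1, b + 1) : State) ∈ blackRegion ρ N
    · have hsum : w + b + 2 = N := by have := hR.1; simp only at this; omega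
      have hsum' : (w : ℝ) + b + 2 = N := by exact_mod_cast hsum
      obtain ⟨h4, h5⟩ := four_le_of_mem_blackRegion hρ hN hR
      have hval : F (w + 1, b + 1) = min (g (w + 1, b + 1)) (m (w + 1, b + 1)) := if_pos hR
      rw [hval]
      refine le_min ?_ hmd
      have h1 := fluidTime_drift_le (w := w) (b := b) (by omega)
      have h2 := barrier_drift hρ (N : ℝ) (w := w) (b := b) (by simpa using hR.2)
      have h3 := average_le_average (w := w) (b := b) (hFg (w + 2, b) (by simp only; omega))
        (hFg (w, b + 2) (by simp only; omega))
      have h2' := mul_le_mul_of_nonneg_left h2 (sq_nonneg (N : ℝ))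
      have h6 : c ≤ 1 - 4 * ((w : ℝ) + b + 2) / ((b : ℝ) - w) ^ 2 := by
        rw [hc, hsum']
        push_cast at h5
        rw [show (b : ℝ) + 1 - (w + 1) = b - w by ring] at h5
        linarith
      have h1' := mul_le_mul_of_nonneg_left ((add_le_add_right h6 _).trans h1) (inv_pos.2 hc0).le
      rw [mul_add, inv_mul_cancel₀ hc0.ne'] at h1'
      have e : (((w : ℝ) + 1) * g (w + 2, b) + ((b : ℝ) + 1) * g (w, b + 2)) / ((w : ℝ) + b + 2)
          = c⁻¹ * ((((w : ℝ) + 1) * fluidTime (w + 2, b) + ((b : ℝ) + 1) * fluidTime (w, b + 2))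
            / ((w : ℝ) + b + 2)) + (N : ℝ) ^ 2 * ((((w : ℝ) + 1) * barrier ρ N (w + 2)
            + ((b : ℝ) + 1) * barrier ρ N w) / ((w : ℝ) + b + 2)) := by
        simp only [hg]; ring
      have e2 : g (w + 1, b + 1)
          = c⁻¹ * fluidTime (w + 1, b + 1) + (N : ℝ) ^ 2 * barrier ρ N (w + 1) := rfl
      linarith
    · have hval : F (w + 1, b + 1) = m (w + 1, b + 1) := if_neg hR
      rw [hval]
      exact hmd
  have hle := T_TA_le hF0 hdrift hpol w b
  have hg' := ENNReal.ofReal_le_ofReal (hFg (w, b) hwb.symm)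
  exact ⟨hle.1.trans hg', hle.2.trans hg'⟩

/-! ### Asymptotics along the initial states -/

lemma initW_add_initB {x : ℝ} (h0 : 0 ≤ x) (h1 : x ≤ 1) (N : ℕ) :
    initW x N + initB x N = N := by
  have hN : (0 : ℝ) ≤ N := N.cast_nonneg
  have hle : initB x N ≤ N := Nat.ceil_le.2 (by nlinarith)
  have : initW x N = N - initB x N := by
    rw [initW, Nat.floor_eq_iff (by nlinarith), Nat.cast_sub hle]
    have h2 := Nat.le_ceil (x * (N : ℝ))
    have h3 := Nat.ceil_lt_add_one (a := x * (N : ℝ)) (by positivity)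
    unfold initB
    constructor <;> linarith
  omega

lemma initW_le {x : ℝ} (h1 : x ≤ 1) (N : ℕ) : (initW x N : ℝ) ≤ (1 - x) * N :=
  Nat.floor_le (mul_nonneg (by linarith) N.cast_nonneg)

lemma tendsto_initW_div {x : ℝ} (h1 : x ≤ 1) :
    Tendsto (fun N : ℕ => (initW x N : ℝ) / N) atTop (𝓝 (1 - x)) :=
  (tendsto_nat_floor_mul_div_atTop (sub_nonneg.2 h1)).comp tendsto_natCast_atTop_atTop

lemma tendsto_initB_div {x : ℝ} (h0 : 0 ≤ x) :
    Tendsto (fun N : ℕ => (initB x N : ℝ) / N) atTop (𝓝 x) :=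
  (tendsto_nat_ceil_mul_div_atTop h0).comp tendsto_natCast_atTop_atTop

lemma tendsto_pow_mul_barrier {x ρ : ℝ} (h1 : x ≤ 1) (hρ : 1 < ρ) (h : ρ * (1 - x) < x) (k : ℕ) :
    Tendsto (fun N : ℕ => (N : ℝ) ^ k * barrier ρ N (initW x N)) atTop (𝓝 0) := by
  have hρ0 : 0 < ρ := by linarith
  -- The exponent of the barrier is at most `-κN`, so geometric decay beats any power of `N`.
  set κ := 1 / (1 + ρ) - (1 - x) with hκ
  have hκ0 : 0 < κ := by
    rw [hκ, sub_pos, lt_div_iff₀ (by linarith)]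
    linarith
  have hr : ρ ^ (-κ) < 1 := Real.rpow_lt_one_of_one_lt_of_neg hρ (by linarith)
  have hlim := tendsto_pow_const_mul_const_pow_of_lt_one k
    (Real.rpow_nonneg hρ0.le (-κ)) hr
  refine squeeze_zero (fun N => mul_nonneg (by positivity) (barrier_pos hρ _ _).le) (fun N => ?_) hlim
  refine mul_le_mul_of_nonneg_left ?_ (by positivity)
  rw [← Real.rpow_mul_natCast hρ0.le, barrier]
  refine Real.rpow_le_rpow_of_exponent_le hρ.le ?_
  have := initW_le h1 N
  rw [hκ]
  calc _ ≤ (1 - x) * N - N / (1 + ρ) := by linarith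
    _ = _ := by ring

lemma tendsto_fluidTime_div {x : ℝ} (hx : 1 / 2 < x) (h1 : x ≤ 1) :
    Tendsto (fun N : ℕ => fluidTime (initW x N, initB x N) / N) atTop
      (𝓝 (1 / 2 * Real.log (1 / (2 * x - 1)))) := by
  have hlim : Tendsto (fun N : ℕ => 1 / 2 * Real.log (1 / ((initB x N : ℝ) / N - (initW x N : ℝ) / N)))
      atTop (𝓝 (1 / 2 * Real.log (1 / (2 * x - 1)))) := by
    have h2 := (tendsto_initB_div (by linarith : 0 ≤ x)).sub (tendsto_initW_div h1)
    rw [show x - (1 - x) = 2 * x - 1 by ring] at h2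
    have h3 : (2 * x - 1) ≠ 0 := by linarith
    exact ((tendsto_const_nhds.div h2 h3).log (one_div_ne_zero h3)).const_mul _
  refine hlim.congr' ?_
  filter_upwards [eventually_gt_atTop 0] with N hN
  have hN0 : (N : ℝ) ≠ 0 := by positivity
  have hsum : (initW x N : ℝ) + initB x N = N := by
    exact_mod_cast initW_add_initB (by linarith) h1 N
  simp only [fluidTime]
  rw [hsum, ← sub_div, one_div_div]
  field_simp

lemma isEquivalent_of_tendsto_div {f : ℕ → ℝ} {c : ℝ} (hc : c ≠ 0)
    (h : Tendsto (fun N => f N / N) atTop (𝓝 c)) : f ~[atTop] fun N : ℕ => (N : ℝ) * c := by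
  have hne : ∀ᶠ N : ℕ in atTop, (N : ℝ) * c ≠ 0 := by
    filter_upwards [eventually_gt_atTop 0] with N hN
    have : (N : ℝ) ≠ 0 := by positivity
    exact mul_ne_zero this hc
  rw [isEquivalent_iff_tendsto_one hne]
  have := h.div_const c
  rw [div_self hc] at this
  refine this.congr fun N => ?_
  simp [div_div]

lemma tendsto_div_of_bounds {x ρ : ℝ} (hx : 1 / 2 < x) (h1 : x ≤ 1) (hρ : 1 < ρ)
    (h : ρ * (1 - x) < x) {t : ℕ → ENNReal}
    (hlo : ∀ᶠ N : ℕ in atTop, ENNReal.ofReal (fluidTime (initW x N, initB x N)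
      - (N : ℝ) ^ 2 * barrier ρ N (initW x N)) ≤ t N)
    (hhi : ∀ᶠ N : ℕ in atTop, t N ≤ ENNReal.ofReal ((1 - 4 / (((ρ - 1) / (ρ + 1)) ^ 2 * (N : ℝ)))⁻¹
      * fluidTime (initW x N, initB x N) + (N : ℝ) ^ 2 * barrier ρ N (initW x N))) :
    Tendsto (fun N => (t N).toReal / N) atTop (𝓝 (1 / 2 * Real.log (1 / (2 * x - 1)))) := by
  have hf := tendsto_fluidTime_div hx h1
  -- Exponent 1, because the gluing error `N² · barrier` is divided by `N`.
  have hb := tendsto_pow_mul_barrier h1 hρ h 1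
  have hδ : ((ρ - 1) / (ρ + 1)) ^ 2 ≠ 0 := by
    have : (ρ - 1) / (ρ + 1) ≠ 0 := (div_pos (by linarith) (by linarith)).ne'
    positivity
  have hc : Tendsto (fun N : ℕ => (1 - 4 / (((ρ - 1) / (ρ + 1)) ^ 2 * (N : ℝ)))⁻¹) atTop (𝓝 1) := by
    have h0 : Tendsto (fun N : ℕ => 4 / (((ρ - 1) / (ρ + 1)) ^ 2 * (N : ℝ))) atTop (𝓝 0) :=
      tendsto_const_nhds.div_atTop
        (tendsto_natCast_atTop_atTop.const_mul_atTop (lt_of_le_of_ne (sq_nonneg _) hδ.symm))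
    simpa using (tendsto_const_nhds.sub h0 : Tendsto _ _ (𝓝 ((1 : ℝ) - 0))).inv₀ (by norm_num)
  have hL := hf.sub hb
  have hU := (hc.mul hf).add hb
  rw [sub_zero] at hL
  rw [one_mul, add_zero] at hU
  refine tendsto_of_tendsto_of_tendsto_of_le_of_le' hL hU ?_ ?_
  · filter_upwards [hlo, hhi, eventually_gt_atTop 0] with N hN hN' hpos
    have hN0 : (0 : ℝ) < N := by positivity
    have htop : t N ≠ ⊤ := ne_top_of_le_ne_top ENNReal.ofReal_ne_top hN'
    rw [le_div_iff₀ hN0]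
    refine le_trans (le_of_eq ?_) ((ENNReal.ofReal_le_iff_le_toReal htop).1 hN)
    field_simp
  · filter_upwards [hhi, eventually_gt_atTop 0, hc.eventually (lt_mem_nhds zero_lt_one)]
      with N hN hpos hcN
    have hN0 : (0 : ℝ) < N := by positivity
    rw [div_le_iff₀ hN0]
    refine (ENNReal.toReal_le_of_le_ofReal ?_ hN).trans (le_of_eq ?_)
    · exact add_nonneg (mul_nonneg hcN.le (fluidTime_nonneg _))
        (mul_nonneg (by positivity) (barrier_pos hρ _ _).le)
    · field_simp

end Mabinogion

end

theorem proposition5 (x : ℝ) (hx_half : 1 / 2 < x) (hx_one : x < 1) :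
    ((fun N : ℕ => Mabinogion.VA (Mabinogion.initW x N) (Mabinogion.initB x N)) ~[atTop]
      fun N : ℕ => Mabinogion.V (Mabinogion.initW x N) (Mabinogion.initB x N)) ∧
    ((fun N : ℕ => Mabinogion.V (Mabinogion.initW x N) (Mabinogion.initB x N)) ~[atTop]
      fun N : ℕ => (N : ℝ)) ∧
    (∀ N : ℕ, Mabinogion.TA (Mabinogion.initW x N) (Mabinogion.initB x N) ≠ ⊤ ∧
      Mabinogion.T (Mabinogion.initW x N) (Mabinogion.initB x N) ≠ ⊤) ∧
    ((fun N : ℕ => (Mabinogion.TA (Mabinogion.initW x N) (Mabinogion.initB x N)).toReal) ~[atTop]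
      fun N : ℕ => (Mabinogion.T (Mabinogion.initW x N) (Mabinogion.initB x N)).toReal) ∧
    ((fun N : ℕ => (Mabinogion.T (Mabinogion.initW x N) (Mabinogion.initB x N)).toReal) ~[atTop]
      fun N : ℕ => (N : ℝ) / 2 * Real.log (1 / (2 * x - 1))) ∧
    Tendsto (fun N : ℕ => Mabinogion.drawLaw {u : Mabinogion.Draws |
        ∀ n : ℕ, Mabinogion.aPath (Mabinogion.initW x N, Mabinogion.initB x N) u n =
          Mabinogion.mPath (Mabinogion.initW x N, Mabinogion.initB x N) u n})
      atTop (𝓝 1) := by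
  open Mabinogion in
  have hx0 : 0 ≤ x := by linarith
  -- `x > 1/2` makes `x/(1 - x) > 1`; a `ρ` strictly in between puts the starting ratio of colours
  -- strictly inside the black region.
  obtain ⟨ρ, hρ, hρx⟩ : ∃ ρ : ℝ, 1 < ρ ∧ ρ < x / (1 - x) :=
    exists_between (by rw [lt_div_iff₀ (by linarith)]; linarith)
  rw [lt_div_iff₀ (by linarith)] at hρx
  have hsum := initW_add_initB hx0 hx_one.le
  -- The probability that Policy A ever acts vanishes in the limit.
  set A : ℕ → Set Draws := fun N => {u | ∃ n, mPath (initW x N, initB x N) u n ∈ policyActs} with hA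
  have hAm : ∀ N, MeasurableSet (A N) := fun N => measurableSet_exists_policyActs _
  have hbar : Tendsto (fun N : ℕ => barrier ρ N (initW x N)) atTop (𝓝 0) := by
    simpa using tendsto_pow_mul_barrier hx_one.le hρ hρx 0
  have hA0 : Tendsto (fun N => drawLaw (A N)) atTop (𝓝 0) := by
    have h2 := ENNReal.tendsto_ofReal hbar
    rw [ENNReal.ofReal_zero] at h2
    refine tendsto_of_tendsto_of_tendsto_of_le_of_le tendsto_const_nhds h2 (fun _ => bot_le)
      fun N => ?_
    have := drawLaw_policyActs_le_barrier hρ (w := initW x N) (b := initB x N)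
    rwa [hsum] at this
  have hAr : Tendsto (fun N => 1 - drawLaw.real (A N)) atTop (𝓝 1) := by
    have := (ENNReal.tendsto_toReal ENNReal.zero_ne_top).comp hA0
    rw [ENNReal.toReal_zero] at this
    simpa [Measure.real] using tendsto_const_nhds.sub this
  -- The expected final numbers of black balls.
  have hVlim : ∀ v : ℕ → ℝ, (∀ᶠ N : ℕ in atTop, v N ∈ Set.Icc ((N : ℝ) * (1 - drawLaw.real (A N))) N) →
      v ~[atTop] fun N : ℕ => (N : ℝ) := by
    intro v hv
    have : Tendsto (fun N => v N / N) atTop (𝓝 1) := by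
      refine tendsto_of_tendsto_of_tendsto_of_le_of_le' hAr tendsto_const_nhds ?_ ?_
      · filter_upwards [hv, eventually_gt_atTop 0] with N hN hpos
        have hN0 : (0 : ℝ) < N := by positivity
        rw [le_div_iff₀ hN0, mul_comm]
        exact hN.1
      · filter_upwards [hv, eventually_gt_atTop 0] with N hN hpos
        have hN0 : (0 : ℝ) < N := by positivity
        exact (div_le_one hN0).2 hN.2
    simpa using isEquivalent_of_tendsto_div one_ne_zero this
  have hVV : ∀ᶠ N : ℕ in atTop,
      V (initW x N) (initB x N) ∈ Set.Icc ((N : ℝ) * (1 - drawLaw.real (A N))) N ∧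
      VA (initW x N) (initB x N) ∈ Set.Icc ((N : ℝ) * (1 - drawLaw.real (A N))) N := by
    filter_upwards [eventually_gt_atTop 0] with N hN
    have hb : 0 < initB x N := Nat.ceil_pos.2 (by positivity)
    have := V_VA_mem_Icc hb (T_ne_top (initW x N) _) (TA_ne_top _ _)
    rwa [hsum] at this
  have hV := hVlim _ (hVV.mono fun _ h => h.1)
  have hVA := hVlim _ (hVV.mono fun _ h => h.2)
  -- The expected absorption times.
  have hlarge : ∀ᶠ N : ℕ in atTop, 4 < ((ρ - 1) / (ρ + 1)) ^ 2 * (N : ℝ) := by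
    have hδ : 0 < (ρ - 1) / (ρ + 1) := div_pos (by linarith) (by linarith)
    exact (tendsto_natCast_atTop_atTop.const_mul_atTop (pow_pos hδ 2)).eventually_gt_atTop 4
  have hlo := hlarge.mono fun N hN => fluidTime_sub_le_T_TA hρ (by rwa [hsum])
  have hhi := hlarge.mono fun N hN => T_TA_le_fluidTime_add hρ (by rwa [hsum])
  simp only [hsum] at hlo hhi
  have hlog : 1 / 2 * Real.log (1 / (2 * x - 1)) ≠ 0 := by
    have : 0 < Real.log (1 / (2 * x - 1)) :=
      Real.log_pos ((one_lt_div (by linarith)).2 (by linarith))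
    positivity
  have hT := isEquivalent_of_tendsto_div hlog (tendsto_div_of_bounds hx_half hx_one.le hρ hρx
    (hlo.mono fun _ h => h.1) (hhi.mono fun _ h => h.1))
  have hTA := isEquivalent_of_tendsto_div hlog (tendsto_div_of_bounds hx_half hx_one.le hρ hρx
    (hlo.mono fun _ h => h.2) (hhi.mono fun _ h => h.2))
  refine ⟨hVA.trans hV.symm, hV, fun N => ⟨TA_ne_top _ _, T_ne_top _ _⟩, hTA.trans hT.symm, ?_, ?_⟩
  · refine hT.congr_right (Eventually.of_forall fun N => ?_)
    simp only
    ring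
  · have h1 : Tendsto (fun N => 1 - drawLaw (A N)) atTop (𝓝 1) := by
      simpa using ENNReal.Tendsto.sub tendsto_const_nhds hA0 (Or.inl ENNReal.one_ne_top)
    refine tendsto_of_tendsto_of_tendsto_of_le_of_le h1 tendsto_const_nhds (fun N => ?_)
      fun N => prob_le_one
    simp only
    rw [← prob_compl_eq_one_sub (hAm N)]
    -- The paths agree off `A N`, so the probability of coincidence is at least that of the
    -- complement.
    exact measure_mono fun u hu n => aPath_eq_mPath (not_exists.1 hu) n
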